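/- Let $\mathcal P=\{1,\dots,N\}$, let $f_i:\mathbb R^n\to\mathbb R^n$, $i\in\mathcal P$, be locally Lipschitz with $f_i(0)=0$, and let $\sigma=(\sigma(t))_{t\ge 0}$ be a càdlàg $\mathcal P$-valued process on a probability space $(\Omega,\mathfrak F,\mathsf P)$ with switching instants $0=\tau_0<\tau_1<\tau_2<\cdots$ (almost surely $\sigma$ is constant on each $[\tau_k,\tau_{k+1})$; the value is allowed to stay the same at a switching instant). Put $S_k:=\tau_k-\tau_{k-1}$ for $k\ge 1$. Consider the randomly switched system $$\dot x(t)=f_{\sigma(t)}(x(t)),\qquad x(0)=x_0,\qquad t\ge 0,$$ with solutions in the sense of Carathéodory and no jumps of $x$ at the switching instants. A function $\alpha:[0,\infty)\to[0,\infty)$ is of class $\mathcal K_\infty$ if it is continuous, strictly increasing and unbounded with $\alpha(0)=0$. The system is *globally asymptotically stable almost surely* (GAS a.s.) if - (AS1) for almost every $\omega$: for every $\varepsilon>0$ there is $\delta>0$ such that $\sup_{t\ge 0}\|x(t)\|<\varepsilon$ for every solution with $\|x_0\|<\delta$; - (AS2) for almost every $\omega$: for all $r,\varepsilon'>0$ there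 is $T\ge 0$ such that $\sup_{t\ge T}\|x(t)\|<\varepsilon'$ for every solution with $\|x_0\|<r$. **Theorem.** Suppose that the following hold. - (G1) There are continuously differentiable functions $V_i:\mathbb R^n\to\mathbb R$, $i\in\mathcal P$, functions $\alpha_1,\alpha_2$ of class $\mathcal K_\infty$, and numbers $\mu>1$ and $\lambda_{i,j}\in\mathbb R$, such that for all $x\in\mathbb R^n$ and $i,j\in\mathcal P$: $\alpha_1(\|x\|)\le V_i(x)\le\alpha_2(\|x\|)$; $\langle\nabla V_i(x),f_j(x)\rangle\le-\lambda_{i,j}V_i(x)$; $V_i(x)\le\mu V_j(x)$. - (G2) The holding times $(S_k)_{k\ge 1}$ are i.i.d. with $\mathsf E[S_1]<\infty$; the process $(\sigma(\tau_k))_{k\ge 0}$ is a discrete-time Markov chain with initial distribution $\delta_{\sigma_0}$ for some $\sigma_0\in\mathcal P$ and transition probability matrix $P=[p_{i,j}]$; and the sequences $(S_k)_{k\ge 1}$ and $(\sigma(\tau_k))_{k\ge 0}$ are independent of each other. - (G3) There is $\theta\in[0,1)$ with $$\max_{i\in\mathcal P}\sum_{j\in\mathcal P}\mu\,p_{i,j}\,\mathsf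 E\bigl[e^{-\lambda_{j,i}S_1}\bigr]\le\theta,$$ where the expectations take values in $[0,\infty]$ and $0\cdot\infty=0$. Then for almost every sample path of $\sigma$ the system has, for every $x_0\in\mathbb R^n$, a unique global solution on $[0,\infty)$, and the system is GAS a.s. -/

import Mathlib

open MeasureTheory ProbabilityTheory Filter Topology
open scoped NNReal ENNReal

noncomputable section

/-- Class `𝒦∞`: continuous, strictly increasing, zero at zero and unbounded functions
`[0, ∞) → [0, ∞)`. -/
structure IsClassKInfty (α : ℝ≥0 → ℝ≥0) : Prop where
  continuous : Continuous α
  strictMono : StrictMono α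
  map_zero : α 0 = 0
  unbounded : Tendsto α atTop atTop

/-- The Lie derivative `⟨∇V(x), f(x)⟩` of `V` along the vector field `f`. -/
def lieDeriv {n : ℕ} (f : EuclideanSpace ℝ (Fin n) → EuclideanSpace ℝ (Fin n))
    (V : EuclideanSpace ℝ (Fin n) → ℝ) (x : EuclideanSpace ℝ (Fin n)) : ℝ :=
  inner ℝ (gradient V x) (f x)

/-- `x` restricted to `[0, ∞)` is a global Carathéodory solution of `ẋ = f_{s(t)}(x)`, `x(0) = x₀`,
for the fixed switching path `s`, in integral form. The integrability of the right-hand side makes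
`x` locally absolutely continuous on `[0, ∞)`. Values at negative times play no role. -/
structure IsSwitchedSolution {n N : ℕ}
    (f : Fin N → EuclideanSpace ℝ (Fin n) → EuclideanSpace ℝ (Fin n))
    (s : ℝ → Fin N) (x₀ : EuclideanSpace ℝ (Fin n)) (x : ℝ → EuclideanSpace ℝ (Fin n)) :
    Prop where
  integrable : ∀ t, 0 ≤ t → IntervalIntegrable (fun u => f (s u) (x u)) volume 0 t
  eq_integral : ∀ t, 0 ≤ t → x t = x₀ + ∫ u in (0 : ℝ)..t, f (s u) (x u)

/-- For almost every sample path of `σ`, every initial state has a global solution on `[0, ∞)`,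
and it is unique there. -/
def AlmostSurelyWellPosed {Ω : Type*} [MeasurableSpace Ω] (Pr : Measure Ω) {n N : ℕ}
    (f : Fin N → EuclideanSpace ℝ (Fin n) → EuclideanSpace ℝ (Fin n))
    (σ : ℝ → Ω → Fin N) : Prop :=
  ∀ᵐ ω ∂Pr, ∀ x₀, ∃ x, IsSwitchedSolution f (fun t => σ t ω) x₀ x ∧
    ∀ y, IsSwitchedSolution f (fun t => σ t ω) x₀ y → Set.EqOn y x (Set.Ici 0)

/-- Global asymptotic stability almost surely. In both properties the quantification over the
initial state is inside the event, so `δ` and `T` depend on the sample path but not on the initial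
state. The suprema are taken in `[0, ∞]`. -/
structure GASAlmostSurely {Ω : Type*} [MeasurableSpace Ω] (Pr : Measure Ω) {n N : ℕ}
    (f : Fin N → EuclideanSpace ℝ (Fin n) → EuclideanSpace ℝ (Fin n))
    (σ : ℝ → Ω → Fin N) : Prop where
  stable : ∀ᵐ ω ∂Pr, ∀ ε : ℝ, 0 < ε → ∃ δ : ℝ, 0 < δ ∧
    ∀ x₀ x, IsSwitchedSolution f (fun t => σ t ω) x₀ x →
      ‖x₀‖ < δ → (⨆ t ∈ Set.Ici (0 : ℝ), ‖x t‖ₑ) < ENNReal.ofReal ε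
  attractive : ∀ᵐ ω ∂Pr, ∀ r ε : ℝ, 0 < r → 0 < ε → ∃ T : ℝ, 0 ≤ T ∧
    ∀ x₀ x, IsSwitchedSolution f (fun t => σ t ω) x₀ x →
      ‖x₀‖ < r → (⨆ t ∈ Set.Ici T, ‖x t‖ₑ) < ENNReal.ofReal ε

/-- `σ = (σ(t))_{t ≥ 0}` is a càdlàg process in the finite set `Fin N` whose switching instants are
`τ 1 < τ 2 < ⋯`, with `τ 0 = 0`: the value of `σ` changes only at these instants. Every
discontinuity point of `σ` before the limit of the `τ k` is then a switching instant; a switching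
instant at which the value is redrawn and happens to stay the same is allowed, as is needed for a
transition matrix with nonzero diagonal entries. That `τ k → ∞` is not assumed. -/
structure IsSwitchingSignal {Ω : Type*} [MeasurableSpace Ω] (Pr : Measure Ω) {N : ℕ}
    (σ : ℝ → Ω → Fin N) (τ : ℕ → Ω → ℝ) : Prop where
  measurable_signal : ∀ t, 0 ≤ t → Measurable (σ t)
  measurable_instant : ∀ k, Measurable (τ k)
  right_continuous : ∀ᵐ ω ∂Pr, ∀ t, 0 ≤ t →
    ContinuousWithinAt (fun u => σ u ω) (Set.Ici t) t
  left_limits : ∀ᵐ ω ∂Pr, ∀ t, 0 < t → ∃ i, Tendsto (fun u => σ u ω) (𝓝[<] t) (𝓝 i)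
  instant_zero : ∀ᵐ ω ∂Pr, τ 0 ω = 0
  instant_strictMono : ∀ᵐ ω ∂Pr, StrictMono fun k => τ k ω
  eq_of_mem : ∀ᵐ ω ∂Pr, ∀ k, ∀ t ∈ Set.Ico (τ k ω) (τ (k + 1) ω), σ t ω = σ (τ k ω) ω

/-- The holding times: `holdingTime τ k` is the time `τ (k + 1) - τ k` between consecutive
switching instants. -/
def holdingTime {Ω : Type*} (τ : ℕ → Ω → ℝ) (k : ℕ) (ω : Ω) : ℝ :=
  τ (k + 1) ω - τ k ω

/-- The jump destinations `σ(τ k)`. -/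
def jumpDestination {Ω : Type*} {N : ℕ} (σ : ℝ → Ω → Fin N) (τ : ℕ → Ω → ℝ) (k : ℕ) (ω : Ω) :
    Fin N :=
  σ (τ k ω) ω

/-- `Y` is a (time-homogeneous) discrete-time Markov chain with initial distribution `δ_{i₀}` and
transition probability matrix `P`. -/
structure IsMarkovChain {Ω : Type*} [MeasurableSpace Ω] (Pr : Measure Ω) {N : ℕ}
    (Y : ℕ → Ω → Fin N) (i₀ : Fin N) (P : Matrix (Fin N) (Fin N) ℝ) : Prop where
  stochastic : P ∈ Matrix.rowStochastic ℝ (Fin N)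
  measurable : ∀ k, Measurable (Y k)
  initial : Pr.map (Y 0) = Measure.dirac i₀
  transition : ∀ (k : ℕ) (i : ℕ → Fin N) (j : Fin N),
    Pr {ω | ∀ l ≤ k, Y l ω = i l} ≠ 0 →
      Pr[{ω | Y (k + 1) ω = j} | {ω | ∀ l ≤ k, Y l ω = i l}] = ENNReal.ofReal (P (i k) j)

/-- Class GH: i.i.d. holding times with finite mean, Markovian jump destinations, and the two
sequences independent of each other. -/
structure IsClassGH {Ω : Type*} [MeasurableSpace Ω] (Pr : Measure Ω) {N : ℕ}
    (σ : ℝ → Ω → Fin N) (τ : ℕ → Ω → ℝ) (i₀ : Fin N) (P : Matrix (Fin N) (Fin N) ℝ) :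
    Prop where
  iIndep : iIndepFun (holdingTime τ) Pr
  identDistrib : ∀ k, IdentDistrib (holdingTime τ k) (holdingTime τ 0) Pr Pr
  integrable : Integrable (holdingTime τ 0) Pr
  markov : IsMarkovChain Pr (jumpDestination σ τ) i₀ P
  indep : IndepFun (fun ω k => holdingTime τ k ω) (fun ω k => jumpDestination σ τ k ω) Pr

end

/-! On each interval between switching instants, follow the Lyapunov function of the next mode, not
of the active one. Changing to it when the interval begins costs a factor `μ`; while mode `i` is
active and `j` comes next, it is multiplied by at most `exp (-lam j i * S)` over a holding time `S`.
This is the index order of the contraction condition. At the `k`-th instant the Lyapunov value is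
thus at most `M k` times its initial value, where `M k` (`decayFactor`) is a product over
consecutive pairs of modes (`IsSwitchedSolution.lyapunov_le`).

Freezing the chain, independence of the holding times factorizes the expectation of `M k` into
weights of transitions. Averaging over the chain one transition at a time then gives at most `θ ^ k`
(`IsMarkovChain.setLIntegral_prod_le`, `IsClassGH.lintegral_decayFactor_le`). These bounds are
summable, so `M k → 0` almost surely. The bound on `V` has coefficients that depend only on the
sample path: their boundedness gives stability, their convergence to zero gives attractivity.

The strong law makes the switching instants tend to infinity. Each `V i` grows at most exponentially
along its own subsystem and is proper, so no subsystem blows up and solutions can be glued over all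
of `[0, ∞)`. -/

theorem LocallyLipschitz.smul {E F : Type*} [NormedAddCommGroup E] [NormedAddCommGroup F]
    [NormedSpace ℝ F] {ρ : E → ℝ} {g : E → F} (hρ : LocallyLipschitz ρ)
    (hg : LocallyLipschitz g) : LocallyLipschitz fun y => ρ y • g y :=
  (contDiff_smul (𝕜 := ℝ) (n := 1) (F := F)).locallyLipschitz.comp (hρ.prodMk hg)

/-! ### Autonomous integral equations: uniqueness and bounded fields -/

section IntegralEquation

variable {E : Type*} [NormedAddCommGroup E] [NormedSpace ℝ E] [CompleteSpace E]

/-- A continuous solution of the integral equation of an autonomous ODE is right differentiable. -/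
theorem hasDerivWithinAt_of_eq_integral {g : E → E} (hg : Continuous g) {x : ℝ → E} {a b : ℝ}
    (hx : ContinuousOn x (Set.Icc a b))
    (h : ∀ t ∈ Set.Icc a b, x t = x a + ∫ u in a..t, g (x u)) :
    ∀ t ∈ Set.Ico a b, HasDerivWithinAt x (g (x t)) (Set.Ici t) t := by
  intro t ht
  have htI : t ∈ Set.Icc a b := Set.Ico_subset_Icc_self ht
  have := Fact.mk htI
  have hc : ContinuousOn (fun u => g (x u)) (Set.Icc a b) := hg.comp_continuousOn hx
  have key : HasDerivWithinAt (fun s => ∫ u in a..s, g (x u)) (g (x t)) (Set.Icc a b) t := by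
    apply intervalIntegral.integral_hasDerivWithinAt_right
    · exact (hc.mono (Set.Icc_subset_Icc le_rfl htI.2)).intervalIntegrable_of_Icc htI.1
    · exact hc.stronglyMeasurableAtFilter_nhdsWithin measurableSet_Icc t
    · exact hc.continuousWithinAt htI
  have key2 : HasDerivWithinAt x (g (x t)) (Set.Icc a b) t :=
    (key.const_add (x a)).congr (fun s hs => h s hs) (h t htI)
  refine key2.mono_of_mem_nhdsWithin ?_
  exact mem_of_superset (Icc_mem_nhdsGE ht.2) (Set.Icc_subset_Icc_left ht.1)

/-- Uniqueness for the integral equation of a locally Lipschitz autonomous ODE. -/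
theorem eqOn_Icc_of_eq_integral [ProperSpace E] {g : E → E} (hg : LocallyLipschitz g)
    {x y : ℝ → E} {a b : ℝ} (hx : ContinuousOn x (Set.Icc a b)) (hy : ContinuousOn y (Set.Icc a b))
    (hxi : ∀ t ∈ Set.Icc a b, x t = x a + ∫ u in a..t, g (x u))
    (hyi : ∀ t ∈ Set.Icc a b, y t = y a + ∫ u in a..t, g (y u)) (hxy : x a = y a) :
    Set.EqOn x y (Set.Icc a b) := by
  -- Both trajectories lie in one compact set, on which a single Lipschitz constant is available.
  have hcpt : IsCompact (x '' Set.Icc a b ∪ y '' Set.Icc a b) :=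
    (isCompact_Icc.image_of_continuousOn hx).union (isCompact_Icc.image_of_continuousOn hy)
  obtain ⟨K, hK⟩ := (hg.locallyLipschitzOn (s := _)).exists_lipschitzOnWith_of_compact hcpt
  exact ODE_solution_unique_of_mem_Icc_right (v := fun _ => g)
    (s := fun _ => x '' Set.Icc a b ∪ y '' Set.Icc a b) (K := K) (fun t _ => hK) hx
    (hasDerivWithinAt_of_eq_integral hg.continuous hx hxi)
    (fun t ht => Or.inl ⟨t, Set.Ico_subset_Icc_self ht, rfl⟩) hy
    (hasDerivWithinAt_of_eq_integral hg.continuous hy hyi)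
    (fun t ht => Or.inr ⟨t, Set.Ico_subset_Icc_self ht, rfl⟩) hxy

/-- A bounded locally Lipschitz vector field has solutions on every compact interval. -/
theorem exists_eq_integral_of_bounded [ProperSpace E] {g : E → E} (hg : LocallyLipschitz g)
    {C : ℝ≥0} (hC : ∀ y, ‖g y‖ ≤ C) {a b : ℝ} (hab : a ≤ b) (z : E) :
    ∃ x : ℝ → E, x a = z ∧ ContinuousOn x (Set.Icc a b) ∧
      ∀ t ∈ Set.Icc a b, x t = x a + ∫ u in a..t, g (x u) := by
  -- A curve of speed at most `C` cannot leave the ball of radius `C * (b - a)` in the available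
  -- time, so one Picard–Lindelöf step covers the whole interval.
  set A : ℝ≥0 := C * (b - a).toNNReal
  obtain ⟨K, hK⟩ := (hg.locallyLipschitzOn (s := _)).exists_lipschitzOnWith_of_compact
    (isCompact_closedBall z (A : ℝ))
  have hP : IsPicardLindelof (fun _ => g) (⟨a, Set.left_mem_Icc.2 hab⟩ : Set.Icc a b) z A 0 C K := by
    refine ⟨fun t _ => hK, fun y _ => continuousOn_const, fun t _ y _ => hC y, ?_⟩
    have : max (b - a) (a - a) = b - a := by rw [sub_self]; exact max_eq_left (by linarith)
    simp [A, hab]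
  obtain ⟨x, hxa, hx⟩ := hP.exists_eq_forall_mem_Icc_hasDerivWithinAt₀
  have hxc : ContinuousOn x (Set.Icc a b) := fun t ht => (hx t ht).continuousWithinAt
  refine ⟨x, hxa, hxc, fun t ht => ?_⟩
  have hc : ContinuousOn (fun u => g (x u)) (Set.Icc a t) :=
    hg.continuous.comp_continuousOn (hxc.mono (Set.Icc_subset_Icc_right ht.2))
  rw [intervalIntegral.integral_eq_sub_of_hasDeriv_right_of_le ht.1
    (hxc.mono (Set.Icc_subset_Icc_right ht.2)) (fun u hu => ?_)
    (hc.intervalIntegrable_of_Icc ht.1)]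
  · abel
  · refine (hx u ⟨hu.1.le, hu.2.le.trans ht.2⟩).mono_of_mem_nhdsWithin ?_
    exact mem_of_superset (Ioc_mem_nhdsGT (hu.2.trans_le ht.2))
      (fun v hv => ⟨hu.1.le.trans hv.1.le, hv.2⟩)

end IntegralEquation

/-! ### Lyapunov estimates and absence of blow-up -/

section Lyapunov

variable {n : ℕ}

/-- A differential inequality for `V` along a vector field gives an exponential bound for `V` along
its solutions. -/
theorem le_mul_exp_of_lieDeriv_le {g : EuclideanSpace ℝ (Fin n) → EuclideanSpace ℝ (Fin n)}
    (hg : Continuous g) {V : EuclideanSpace ℝ (Fin n) → ℝ} (hV : ContDiff ℝ 1 V) {c : ℝ}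
    (hc : ∀ y, lieDeriv g V y ≤ c * V y) {x : ℝ → EuclideanSpace ℝ (Fin n)} {a b : ℝ}
    (hx : ContinuousOn x (Set.Icc a b))
    (h : ∀ t ∈ Set.Icc a b, x t = x a + ∫ u in a..t, g (x u)) :
    ∀ t ∈ Set.Icc a b, V (x t) ≤ V (x a) * Real.exp (c * (t - a)) := by
  have hD : ∀ s ∈ Set.Ico a b,
      HasDerivWithinAt (fun s => V (x s)) (lieDeriv g V (x s)) (Set.Ici s) s := by
    intro s hs
    have h1 : HasFDerivAt V (fderiv ℝ V (x s)) (x s) :=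
      (hV.differentiable one_ne_zero (x s)).hasFDerivAt
    have h3 : lieDeriv g V (x s) = fderiv ℝ V (x s) (g (x s)) :=
      InnerProductSpace.toDual_symm_apply
    rw [h3]
    exact h1.comp_hasDerivWithinAt s (hasDerivWithinAt_of_eq_integral hg hx h s hs)
  have key := le_gronwallBound_of_liminf_deriv_right_le (f := fun s => V (x s))
    (f' := fun s => lieDeriv g V (x s)) (δ := V (x a)) (K := c) (ε := 0) (a := a) (b := b)
    (hV.continuous.comp_continuousOn hx)
    (fun s hs r hr => by
      simpa only [slope, vsub_eq_sub, smul_eq_mul] using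
        (hD s hs).liminf_right_slope_le hr) le_rfl
    (fun s _ => by simpa only [add_zero] using hc (x s))
  intro t ht
  simpa only [gronwallBound_ε0] using key t ht

/-- If a proper nonnegative function grows at most exponentially along a locally Lipschitz vector
field, solutions exist on every compact interval. -/
theorem exists_eq_integral_of_lieDeriv_le
    {g : EuclideanSpace ℝ (Fin n) → EuclideanSpace ℝ (Fin n)}
    (hg : LocallyLipschitz g) {V : EuclideanSpace ℝ (Fin n) → ℝ} (hV : ContDiff ℝ 1 V)
    (hV0 : ∀ y, 0 ≤ V y) (hVp : ∀ C, ∃ R, ∀ y, V y ≤ C → ‖y‖ ≤ R) {c : ℝ}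
    (hc : ∀ y, lieDeriv g V y ≤ c * V y) {a b : ℝ} (hab : a ≤ b) (z : EuclideanSpace ℝ (Fin n)) :
    ∃ x : ℝ → EuclideanSpace ℝ (Fin n), x a = z ∧ ContinuousOn x (Set.Icc a b) ∧
      ∀ t ∈ Set.Icc a b, x t = x a + ∫ u in a..t, g (x u) := by
  -- The field is cut off outside the ball of radius `|R| + 1`. With `|c|` in place of `c`, the
  -- growth inequality survives multiplication by a cutoff with values in `[0, 1]`. The truncated
  -- solution therefore stays where the cutoff equals one and solves the original equation.
  obtain ⟨R, hR⟩ := hVp (V z * Real.exp (|c| * (b - a)))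
  let ρ : ContDiffBump (0 : EuclideanSpace ℝ (Fin n)) :=
    ⟨|R| + 1, |R| + 2, by positivity, by linarith⟩
  have hgρ : LocallyLipschitz fun y => ρ y • g y := by
    have h1 : ContDiff ℝ 1 ρ := ρ.contDiff
    exact h1.locallyLipschitz.smul hg
  obtain ⟨C, hC⟩ := (ρ.hasCompactSupport.smul_right (f' := g)).exists_bound_of_continuous
    hgρ.continuous
  obtain ⟨x, hxa, hxc, hxi⟩ := exists_eq_integral_of_bounded hgρ (C := C.toNNReal)
    (fun y => (hC y).trans (Real.le_coe_toNNReal C)) hab z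
  have hbd : ∀ t ∈ Set.Icc a b, ‖x t‖ ≤ R := by
    intro t ht
    refine hR _ ((le_mul_exp_of_lieDeriv_le hgρ.continuous hV (c := |c|) ?_ hxc hxi t ht).trans ?_)
    · intro y
      have h1 : lieDeriv (fun y => ρ y • g y) V y = ρ y * lieDeriv g V y := by
        simp only [lieDeriv, inner_smul_right]
      rw [h1]
      have h2 : lieDeriv g V y ≤ |c| * V y :=
        (hc y).trans (mul_le_mul_of_nonneg_right (le_abs_self c) (hV0 y))
      have h3 : 0 ≤ |c| * V y := mul_nonneg (abs_nonneg c) (hV0 y)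
      calc ρ y * lieDeriv g V y ≤ ρ y * (|c| * V y) := mul_le_mul_of_nonneg_left h2 ρ.nonneg
        _ ≤ |c| * V y := mul_le_of_le_one_left h3 ρ.le_one
    · rw [hxa]
      have := ht.2
      gcongr
      exact hV0 z
  refine ⟨x, hxa, hxc, fun t ht => (hxi t ht).trans ?_⟩
  congr 1
  refine intervalIntegral.integral_congr fun u hu => ?_
  rw [Set.uIcc_of_le ht.1] at hu
  have h1 : ‖x u‖ ≤ R := hbd u ⟨hu.1, hu.2.trans ht.2⟩
  have h2 : ρ (x u) = 1 := by
    refine ρ.one_of_mem_closedBall ?_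
    rw [mem_closedBall_zero_iff]
    exact h1.trans ((le_abs_self R).trans (by simp [ρ]))
  simp [h2]

end Lyapunov

/-! ### Switching paths and gluing of subsystem solutions -/

/-- `s` is piecewise constant on `[0, ∞)`, with switching instants `T k` tending to infinity. -/
structure IsSwitchingPath {N : ℕ} (s : ℝ → Fin N) (T : ℕ → ℝ) : Prop where
  zero : T 0 = 0
  strictMono : StrictMono T
  tendsto : Tendsto T atTop atTop
  eq_of_mem : ∀ k, ∀ t ∈ Set.Ico (T k) (T (k + 1)), s t = s (T k)

namespace IsSwitchingPath

variable {N : ℕ} {s : ℝ → Fin N} {T : ℕ → ℝ}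

theorem nonneg (h : IsSwitchingPath s T) (k : ℕ) : 0 ≤ T k :=
  h.zero ▸ h.strictMono.monotone (Nat.zero_le k)

theorem le_succ (h : IsSwitchingPath s T) (k : ℕ) : T k ≤ T (k + 1) :=
  (h.strictMono k.lt_succ_self).le

theorem exists_mem_Ico (h : IsSwitchingPath s T) (K : ℕ) {t : ℝ} (ht : T K ≤ t) :
    ∃ k, K ≤ k ∧ t ∈ Set.Ico (T k) (T (k + 1)) := by
  classical
  have hex : ∃ k, t < T (k + 1) :=
    ((tendsto_add_atTop_iff_nat 1).2 h.tendsto |>.eventually_gt_atTop t).exists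
  have h2 : T (Nat.find hex) ≤ t := by
    rcases Nat.eq_zero_or_pos (Nat.find hex) with h0 | h0
    · rw [h0]
      exact (h.strictMono.monotone (Nat.zero_le K)).trans ht
    · have := Nat.find_min hex (Nat.sub_one_lt_of_lt h0)
      rw [Nat.sub_add_cancel h0] at this
      exact not_lt.1 this
  refine ⟨Nat.find hex, ?_, h2, Nat.find_spec hex⟩
  exact Nat.lt_succ_iff.1 (h.strictMono.lt_iff_lt.1 (ht.trans_lt (Nat.find_spec hex)))

/-- The open interval is needed because `s` may already have its next value at `T (k + 1)`;
integrals do not see the endpoint. -/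
theorem eqOn_uIoo (h : IsSwitchingPath s T) {n : ℕ}
    (f : Fin N → EuclideanSpace ℝ (Fin n) → EuclideanSpace ℝ (Fin n))
    (x : ℝ → EuclideanSpace ℝ (Fin n)) {k : ℕ} {t : ℝ} (ht : t ∈ Set.Icc (T k) (T (k + 1))) :
    Set.EqOn (fun u => f (s (T k)) (x u)) (fun u => f (s u) (x u)) (Set.uIoo (T k) t) := by
  intro u hu
  rw [Set.uIoo_of_le ht.1] at hu
  simp only [h.eq_of_mem k u ⟨hu.1.le, hu.2.trans_le ht.2⟩]

end IsSwitchingPath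

namespace IsSwitchedSolution

variable {n N : ℕ} {f : Fin N → EuclideanSpace ℝ (Fin n) → EuclideanSpace ℝ (Fin n)}
  {s : ℝ → Fin N} {T : ℕ → ℝ} {x₀ : EuclideanSpace ℝ (Fin n)} {x : ℝ → EuclideanSpace ℝ (Fin n)}

theorem map_zero (hx : IsSwitchedSolution f s x₀ x) : x 0 = x₀ := by
  simpa using hx.eq_integral 0 le_rfl

theorem continuousOn (hx : IsSwitchedSolution f s x₀ x) (b : ℝ) :
    ContinuousOn x (Set.Icc 0 b) := by
  rcases lt_or_ge b 0 with hb | hb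
  · simp [Set.Icc_eq_empty_of_lt hb]
  · have h1 := intervalIntegral.continuousOn_primitive_interval' (hx.integrable b hb)
      Set.left_mem_uIcc
    rw [Set.uIcc_of_le hb] at h1
    exact (continuousOn_const.add h1).congr fun t ht => hx.eq_integral t ht.1

theorem continuousOn_Icc (hx : IsSwitchedSolution f s x₀ x) (hs : IsSwitchingPath s T) (k : ℕ) :
    ContinuousOn x (Set.Icc (T k) (T (k + 1))) :=
  (hx.continuousOn _).mono (Set.Icc_subset_Icc_left (hs.nonneg k))

/-- Between two switching instants a switched solution solves the active subsystem. -/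
theorem eq_integral_Icc (hx : IsSwitchedSolution f s x₀ x) (hs : IsSwitchingPath s T) (k : ℕ) :
    ∀ t ∈ Set.Icc (T k) (T (k + 1)), x t = x (T k) + ∫ u in (T k)..t, f (s (T k)) (x u) := by
  intro t ht
  rw [intervalIntegral.integral_congr_uIoo (hs.eqOn_uIoo f x ht), hx.eq_integral _ (hs.nonneg k),
    hx.eq_integral t ((hs.nonneg k).trans ht.1), add_assoc,
    intervalIntegral.integral_add_adjacent_intervals (hx.integrable _ (hs.nonneg k))]
  exact (hx.integrable _ (hs.nonneg k)).symm.trans (hx.integrable t ((hs.nonneg k).trans ht.1))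

/-- Solving the active subsystem between the switching instants gives a switched solution. -/
theorem of_Icc (hs : IsSwitchingPath s T) (hf : ∀ i, Continuous (f i)) (h0 : x 0 = x₀)
    (hc : ∀ k, ContinuousOn x (Set.Icc (T k) (T (k + 1))))
    (hi : ∀ k, ∀ t ∈ Set.Icc (T k) (T (k + 1)),
      x t = x (T k) + ∫ u in (T k)..t, f (s (T k)) (x u)) :
    IsSwitchedSolution f s x₀ x := by
  have hint : ∀ k, ∀ t ∈ Set.Icc (T k) (T (k + 1)),
      IntervalIntegrable (fun u => f (s u) (x u)) volume (T k) t := by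
    intro k t ht
    refine IntervalIntegrable.congr_uIoo ?_ (hs.eqOn_uIoo f x ht)
    exact (((hf _).comp_continuousOn (hc k)).mono
      (Set.Icc_subset_Icc_right ht.2)).intervalIntegrable_of_Icc ht.1
  have hT : ∀ k, IntervalIntegrable (fun u => f (s u) (x u)) volume 0 (T k) ∧
      x (T k) = x₀ + ∫ u in (0 : ℝ)..(T k), f (s u) (x u) := by
    intro k
    induction k with
    | zero => simp [hs.zero, h0]
    | succ k ih =>
      have hm := Set.right_mem_Icc.2 (hs.le_succ k)
      refine ⟨ih.1.trans (hint k _ hm), ?_⟩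
      rw [hi k _ hm, intervalIntegral.integral_congr_uIoo (hs.eqOn_uIoo f x hm), ih.2, add_assoc,
        intervalIntegral.integral_add_adjacent_intervals ih.1 (hint k _ hm)]
  constructor
  · intro t ht
    obtain ⟨k, -, hk⟩ := hs.exists_mem_Ico 0 (hs.zero.trans_le ht)
    exact (hT k).1.trans (hint k t (Set.Ico_subset_Icc_self hk))
  · intro t ht
    obtain ⟨k, -, hk⟩ := hs.exists_mem_Ico 0 (hs.zero.trans_le ht)
    have hk := Set.Ico_subset_Icc_self hk
    rw [hi k _ hk, intervalIntegral.integral_congr_uIoo (hs.eqOn_uIoo f x hk), (hT k).2, add_assoc,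
      intervalIntegral.integral_add_adjacent_intervals (hT k).1 (hint k t hk)]

theorem eqOn_Ici (hs : IsSwitchingPath s T) (hf : ∀ i, LocallyLipschitz (f i))
    {y : ℝ → EuclideanSpace ℝ (Fin n)} (hx : IsSwitchedSolution f s x₀ x)
    (hy : IsSwitchedSolution f s x₀ y) : Set.EqOn y x (Set.Ici 0) := by
  have hstep : ∀ k, y (T k) = x (T k) → Set.EqOn y x (Set.Icc (T k) (T (k + 1))) := fun k h =>
    eqOn_Icc_of_eq_integral (hf _) (hy.continuousOn_Icc hs k) (hx.continuousOn_Icc hs k)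
      (hy.eq_integral_Icc hs k) (hx.eq_integral_Icc hs k) h
  have hT : ∀ k, y (T k) = x (T k) := by
    intro k
    induction k with
    | zero => rw [hs.zero, hx.map_zero, hy.map_zero]
    | succ k ih => exact hstep k ih (Set.right_mem_Icc.2 (hs.le_succ k))
  intro t ht
  obtain ⟨k, -, hk⟩ := hs.exists_mem_Ico 0 (hs.zero.trans_le ht)
  exact hstep k (hT k) (Set.Ico_subset_Icc_self hk)

theorem exists_of_exists_Icc (hs : IsSwitchingPath s T) (hf : ∀ i, Continuous (f i))
    (hex : ∀ (i : Fin N) (a b : ℝ), a ≤ b → ∀ z : EuclideanSpace ℝ (Fin n),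
      ∃ x : ℝ → EuclideanSpace ℝ (Fin n), x a = z ∧ ContinuousOn x (Set.Icc a b) ∧
        ∀ t ∈ Set.Icc a b, x t = x a + ∫ u in a..t, f i (x u))
    (x₀ : EuclideanSpace ℝ (Fin n)) : ∃ x, IsSwitchedSolution f s x₀ x := by
  classical
  have hex' : ∀ (k : ℕ) (z : EuclideanSpace ℝ (Fin n)), ∃ x : ℝ → EuclideanSpace ℝ (Fin n),
      x (T k) = z ∧ ContinuousOn x (Set.Icc (T k) (T (k + 1))) ∧
      ∀ t ∈ Set.Icc (T k) (T (k + 1)), x t = x (T k) + ∫ u in (T k)..t, f (s (T k)) (x u) :=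
    fun k z => hex (s (T k)) _ _ (hs.le_succ k) z
  choose Φ hΦ0 hΦc hΦi using hex'
  let z : ℕ → EuclideanSpace ℝ (Fin n) := fun k => Nat.rec x₀ (fun k z => Φ k z (T (k + 1))) k
  have hidx : ∀ t : ℝ, ∃ k, 0 ≤ t → t ∈ Set.Ico (T k) (T (k + 1)) := by
    intro t
    by_cases ht : 0 ≤ t
    · obtain ⟨k, -, hk⟩ := hs.exists_mem_Ico 0 (hs.zero.trans_le ht)
      exact ⟨k, fun _ => hk⟩
    · exact ⟨0, fun h => absurd h ht⟩
  choose κ hκ using hidx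
  have hκ_eq : ∀ k, ∀ t ∈ Set.Ico (T k) (T (k + 1)), κ t = k := by
    intro k t ht
    have h1 := hκ t ((hs.nonneg k).trans ht.1)
    have h2 := hs.strictMono.lt_iff_lt.1 (h1.1.trans_lt ht.2)
    have h3 := hs.strictMono.lt_iff_lt.1 (ht.1.trans_lt h1.2)
    omega
  let x : ℝ → EuclideanSpace ℝ (Fin n) := fun t => Φ (κ t) (z (κ t)) t
  have hxI : ∀ k, Set.EqOn x (Φ k (z k)) (Set.Icc (T k) (T (k + 1))) := by
    intro k t ht
    -- At the right endpoint `κ` already selects the next piece, whose initial value `z (k + 1)` is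
    -- by construction the final value of the current one.
    rcases ht.2.lt_or_eq with h | h
    · simp only [x, hκ_eq k t ⟨ht.1, h⟩]
    · have h1 : κ t = k + 1 := by
        refine hκ_eq (k + 1) t ⟨h.ge, ?_⟩
        rw [h]
        exact hs.strictMono (k + 1).lt_succ_self
      simp only [x, h1]
      rw [h, hΦ0]
  have hxT : ∀ k, x (T k) = Φ k (z k) (T k) := fun k => hxI k (Set.left_mem_Icc.2 (hs.le_succ k))
  refine ⟨x, of_Icc hs hf ?_ (fun k => (hΦc k (z k)).congr (hxI k)) (fun k t ht => ?_)⟩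
  · rw [← hs.zero, hxT 0, hΦ0]
    rfl
  · rw [hxI k ht, hxT k, hΦi k (z k) t ht]
    congr 1
    refine intervalIntegral.integral_congr fun u hu => ?_
    rw [Set.uIcc_of_le ht.1] at hu
    simp only [hxI k ⟨hu.1, hu.2.trans ht.2⟩]

end IsSwitchedSolution

/-! ### Decay of the Lyapunov functions along a fixed path -/

section Decay

variable {n N : ℕ} {f : Fin N → EuclideanSpace ℝ (Fin n) → EuclideanSpace ℝ (Fin n)}
  {s : ℝ → Fin N} {T : ℕ → ℝ} {V : Fin N → EuclideanSpace ℝ (Fin n) → ℝ} {α₁ α₂ : ℝ≥0 → ℝ≥0}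
  {μ : ℝ} {lam : Fin N → Fin N → ℝ}

/-- The bound for the Lyapunov function at the `k`-th switching instant, relative to its initial
value. -/
noncomputable def decayFactor {N : ℕ} (μ : ℝ) (lam : Fin N → Fin N → ℝ) (y : ℕ → Fin N)
    (S : ℕ → ℝ) (k : ℕ) : ℝ :=
  ∏ l ∈ Finset.range k, μ * Real.exp (-lam (y (l + 1)) (y l) * S l)

theorem decayFactor_pos (hμ : 0 < μ) (y : ℕ → Fin N) (S : ℕ → ℝ) (k : ℕ) :
    0 < decayFactor μ lam y S k :=
  Finset.prod_pos fun _ _ => mul_pos hμ (Real.exp_pos _)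

theorem decayFactor_succ (y : ℕ → Fin N) (S : ℕ → ℝ) (k : ℕ) :
    decayFactor μ lam y S (k + 1) =
      decayFactor μ lam y S k * (μ * Real.exp (-lam (y (k + 1)) (y k) * S k)) :=
  Finset.prod_range_succ _ _

/-- The function of the coming mode is used from `T k` on, so at `T (k + 1)` no further comparison
is needed and the induction over the instants closes. -/
theorem IsSwitchedSolution.lyapunov_le (hs : IsSwitchingPath s T)
    (hf : ∀ i, Continuous (f i)) (hV : ∀ i, ContDiff ℝ 1 (V i)) (hV0 : ∀ i x, 0 ≤ V i x)
    (hμ : 0 < μ) (hV2 : ∀ i j x, lieDeriv (f j) (V i) x ≤ -lam i j * V i x)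
    (hV3 : ∀ i j x, V i x ≤ μ * V j x) {x₀ : EuclideanSpace ℝ (Fin n)}
    {x : ℝ → EuclideanSpace ℝ (Fin n)} (hx : IsSwitchedSolution f s x₀ x)
    {M : ℕ → ℝ} (hM : M = decayFactor μ lam (fun k => s (T k)) (fun k => T (k + 1) - T k))
    (k : ℕ) {t : ℝ} (ht : t ∈ Set.Icc (T k) (T (k + 1))) :
    V (s (T (k + 1))) (x t) ≤ (μ * M k + M (k + 1)) * V (s (T 0)) x₀ := by
  have hM0 : ∀ k, 0 < M k := fun k => hM ▸ decayFactor_pos hμ _ _ _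
  have hMs : ∀ k, M (k + 1) =
      M k * (μ * Real.exp (-lam (s (T (k + 1))) (s (T k)) * (T (k + 1) - T k))) :=
    fun k => hM ▸ decayFactor_succ _ _ _
  have hstep : ∀ k, ∀ t ∈ Set.Icc (T k) (T (k + 1)), V (s (T (k + 1))) (x t) ≤
      μ * V (s (T k)) (x (T k)) * Real.exp (-lam (s (T (k + 1))) (s (T k)) * (t - T k)) := by
    intro k t ht
    refine (le_mul_exp_of_lieDeriv_le (hf _) (hV _) (hV2 _ _) (hx.continuousOn_Icc hs k)
      (hx.eq_integral_Icc hs k) t ht).trans ?_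
    exact mul_le_mul_of_nonneg_right (hV3 _ _ _) (Real.exp_pos _).le
  have hT : ∀ k, V (s (T k)) (x (T k)) ≤ M k * V (s (T 0)) x₀ := by
    intro k
    induction k with
    | zero => simp [hM, decayFactor, hs.zero, hx.map_zero]
    | succ k ih =>
      refine (hstep k _ (Set.right_mem_Icc.2 (hs.le_succ k))).trans ?_
      rw [hMs]
      set e := Real.exp (-lam (s (T (k + 1))) (s (T k)) * (T (k + 1) - T k))
      have he : 0 ≤ μ * e := mul_nonneg hμ.le (Real.exp_pos _).le
      calc μ * V (s (T k)) (x (T k)) * e = (μ * e) * V (s (T k)) (x (T k)) := by ring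
        _ ≤ (μ * e) * (M k * V (s (T 0)) x₀) := mul_le_mul_of_nonneg_left ih he
        _ = _ := by ring
  refine (hstep k t ht).trans ?_
  rw [hMs]
  set l := lam (s (T (k + 1))) (s (T k))
  -- The rate may have either sign, so the exponential is largest at one of the two ends; the sum of
  -- both end values dominates it. This produces the weight `μ * M k + M (k + 1)`.
  have hexp : Real.exp (-l * (t - T k)) ≤ 1 + Real.exp (-l * (T (k + 1) - T k)) := by
    rcases le_total 0 l with hl | hl
    · have : Real.exp (-l * (t - T k)) ≤ 1 :=
        Real.exp_le_one_iff.2 (mul_nonpos_of_nonpos_of_nonneg (by linarith) (by linarith [ht.1]))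
      linarith [Real.exp_pos (-l * (T (k + 1) - T k))]
    · have : Real.exp (-l * (t - T k)) ≤ Real.exp (-l * (T (k + 1) - T k)) :=
        Real.exp_le_exp.2 (mul_le_mul_of_nonneg_left (by linarith [ht.2]) (by linarith))
      linarith
  have h0 : 0 ≤ M k * V (s (T 0)) x₀ := mul_nonneg (hM0 k).le (hV0 _ _)
  calc μ * V (s (T k)) (x (T k)) * Real.exp (-l * (t - T k))
      ≤ μ * (M k * V (s (T 0)) x₀) * (1 + Real.exp (-l * (T (k + 1) - T k))) := by
        gcongr
        exact hT k
    _ = _ := by ring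

/-- If all the weights `c k` of the Lyapunov bound are small enough compared with the initial
state, the solution stays small. -/
theorem iSup_enorm_lt_of_lyapunov_le (hs : IsSwitchingPath s T) (hα₁ : StrictMono α₁)
    (hα₂ : Monotone α₂) (hV1 : ∀ i x, (α₁ ‖x‖₊ : ℝ) ≤ V i x ∧ V i x ≤ (α₂ ‖x‖₊ : ℝ))
    {x₀ : EuclideanSpace ℝ (Fin n)} {x : ℝ → EuclideanSpace ℝ (Fin n)} {c : ℕ → ℝ}
    (hc : ∀ k, 0 ≤ c k)
    (hx : ∀ k, ∀ t ∈ Set.Icc (T k) (T (k + 1)),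
      V (s (T (k + 1))) (x t) ≤ c k * V (s (T 0)) x₀)
    {K : ℕ} {r : ℝ} (hr : ‖x₀‖ < r) {ε : ℝ} (hε : 0 < ε)
    (hK : ∀ k, K ≤ k → c k * α₂ r.toNNReal < α₁ (ε / 2).toNNReal) :
    (⨆ t ∈ Set.Ici (T K), ‖x t‖ₑ) < ENNReal.ofReal ε := by
  -- Pointwise bounds only give a non-strict bound on the supremum; `ε / 2` restores strictness.
  refine lt_of_le_of_lt ?_ ((ENNReal.ofReal_lt_ofReal_iff hε).2 (half_lt_self hε))
  refine iSup₂_le fun t ht => ?_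
  obtain ⟨k, hk, htk⟩ := hs.exists_mem_Ico K ht
  have h1 : (α₁ ‖x t‖₊ : ℝ) < α₁ (ε / 2).toNNReal := by
    refine ((hV1 _ _).1.trans (hx k t (Set.Ico_subset_Icc_self htk))).trans_lt ?_
    refine lt_of_le_of_lt (mul_le_mul_of_nonneg_left ((hV1 _ _).2.trans ?_) (hc k)) (hK k hk)
    exact NNReal.coe_le_coe.2 (hα₂ (NNReal.le_toNNReal_of_coe_le hr.le))
  have h2 := hα₁.lt_iff_lt.1 (NNReal.coe_lt_coe.1 h1)
  rw [enorm_eq_nnnorm, ENNReal.ofReal]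
  exact ENNReal.coe_le_coe.2 h2.le

end Decay

/-! ### Expected products of weights along a Markov chain -/

section MarkovChain

variable {Ω : Type*} [MeasurableSpace Ω] {Pr : Measure Ω} {N : ℕ} {Y : ℕ → Ω → Fin N}
  {i₀ : Fin N} {P : Matrix (Fin N) (Fin N) ℝ}

theorem IsMarkovChain.measurableSet_prefix (hY : IsMarkovChain Pr Y i₀ P) (k : ℕ)
    (i : ℕ → Fin N) : MeasurableSet {ω | ∀ l ≤ k, Y l ω = i l} := by
  have : {ω | ∀ l ≤ k, Y l ω = i l} = ⋂ l, ⋂ (_ : l ≤ k), Y l ⁻¹' {i l} := by ext; simp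
  rw [this]
  exact MeasurableSet.iInter fun l => MeasurableSet.iInter fun _ =>
    hY.measurable l (measurableSet_singleton _)

theorem IsMarkovChain.measure_prefix_inter [IsProbabilityMeasure Pr]
    (hY : IsMarkovChain Pr Y i₀ P) (k : ℕ) (i : ℕ → Fin N) (j : Fin N) :
    Pr ({ω | ∀ l ≤ k, Y l ω = i l} ∩ {ω | Y (k + 1) ω = j}) =
      Pr {ω | ∀ l ≤ k, Y l ω = i l} * ENNReal.ofReal (P (i k) j) := by
  by_cases h0 : Pr {ω | ∀ l ≤ k, Y l ω = i l} = 0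
  · rw [h0, zero_mul]
    exact measure_mono_null Set.inter_subset_left h0
  · rw [← hY.transition k i j h0, cond_apply (hY.measurableSet_prefix k i), ← mul_assoc,
      ENNReal.mul_inv_cancel h0 (measure_ne_top _ _), one_mul]

/-- If every row sum of the weighted transition matrix is at most `θ`, then the expected product of
the weights along `m` steps, after any prefix, is at most `θ ^ m`. -/
theorem IsMarkovChain.setLIntegral_prod_le [IsProbabilityMeasure Pr]
    (hY : IsMarkovChain Pr Y i₀ P) {w : Fin N → Fin N → ℝ≥0∞} {θ : ℝ≥0∞}
    (hw : ∀ i, ∑ j, ENNReal.ofReal (P i j) * w i j ≤ θ) (m : ℕ) :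
    -- The prefix stays general because the induction on `m` peels off the first transition: each
    -- possible value at time `k + 1` yields a prefix one step longer.
    ∀ (k : ℕ) (i : ℕ → Fin N),
      ∫⁻ ω in {ω | ∀ l ≤ k, Y l ω = i l},
        ∏ l ∈ Finset.range m, w (Y (k + l) ω) (Y (k + l + 1) ω) ∂Pr ≤
      θ ^ m * Pr {ω | ∀ l ≤ k, Y l ω = i l} := by
  induction m with
  | zero => intro k i; simp
  | succ m ih =>
    intro k i
    set A := {ω | ∀ l ≤ k, Y l ω = i l} with hA
    have hAm : MeasurableSet A := hY.measurableSet_prefix k i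
    let B : Fin N → Set Ω := fun j => A ∩ {ω | Y (k + 1) ω = j}
    have hBm : ∀ j, MeasurableSet (B j) := fun j =>
      hAm.inter (hY.measurable (k + 1) (measurableSet_singleton j))
    have hAB : A = ⋃ j, B j := by ext ω; simp [B]
    have hBd : Pairwise (Function.onFun Disjoint B) := by
      intro j j' hjj'
      refine Set.disjoint_left.2 fun ω h h' => hjj' ?_
      exact h.2.symm.trans h'.2
    have hB : ∀ j, B j = {ω | ∀ l ≤ k + 1, Y l ω = Function.update i (k + 1) j l} := by
      intro j
      ext ω
      constructor
      · rintro ⟨h1, h2⟩ l hl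
        rcases Nat.lt_or_eq_of_le hl with h | rfl
        · rw [Function.update_of_ne h.ne]
          exact h1 l (Nat.lt_succ_iff.1 h)
        · simpa using h2
      · intro h
        refine ⟨fun l hl => ?_, by simpa using h (k + 1) le_rfl⟩
        have := h l (hl.trans k.le_succ)
        rwa [Function.update_of_ne (Nat.lt_succ_of_le hl).ne] at this
    have hBle : ∀ j, ∫⁻ ω in B j,
        ∏ l ∈ Finset.range (m + 1), w (Y (k + l) ω) (Y (k + l + 1) ω) ∂Pr ≤
        θ ^ m * Pr A * (ENNReal.ofReal (P (i k) j) * w (i k) j) := by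
      intro j
      have h1 : ∫⁻ ω in B j, ∏ l ∈ Finset.range (m + 1), w (Y (k + l) ω) (Y (k + l + 1) ω) ∂Pr =
          ∫⁻ ω in B j, w (i k) j *
            ∏ l ∈ Finset.range m, w (Y (k + 1 + l) ω) (Y (k + 1 + l + 1) ω) ∂Pr := by
        refine setLIntegral_congr_fun (hBm j) fun ω hω => ?_
        have h2 : Y k ω = i k := hω.1 k le_rfl
        have h3 : Y (k + 1) ω = j := hω.2
        simp only [Finset.prod_range_succ', Nat.add_zero, h2, h3]
        rw [mul_comm]
        congr 1
        refine Finset.prod_congr rfl fun l _ => ?_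
        rw [show k + (l + 1) = k + 1 + l by ring]
      have hmeas : Measurable fun ω =>
          ∏ l ∈ Finset.range m, w (Y (k + 1 + l) ω) (Y (k + 1 + l + 1) ω) :=
        Finset.measurable_prod _ fun l _ =>
          (measurable_of_countable (fun p : Fin N × Fin N => w p.1 p.2)).comp
            ((hY.measurable _).prodMk (hY.measurable _))
      rw [h1, lintegral_const_mul _ hmeas]
      have h4 := ih (k + 1) (Function.update i (k + 1) j)
      rw [← hB j, hY.measure_prefix_inter k i j] at h4
      calc _ ≤ w (i k) j * (θ ^ m * (Pr A * ENNReal.ofReal (P (i k) j))) := by gcongr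
        _ = _ := by ring
    calc _ = ∑ j, ∫⁻ ω in B j,
          ∏ l ∈ Finset.range (m + 1), w (Y (k + l) ω) (Y (k + l + 1) ω) ∂Pr := by
          rw [hAB, lintegral_iUnion hBm hBd, tsum_fintype]
      _ ≤ ∑ j, θ ^ m * Pr A * (ENNReal.ofReal (P (i k) j) * w (i k) j) :=
          Finset.sum_le_sum fun j _ => hBle j
      _ = θ ^ m * Pr A * ∑ j, ENNReal.ofReal (P (i k) j) * w (i k) j := by rw [Finset.mul_sum]
      _ ≤ θ ^ m * Pr A * θ := by gcongr; exact hw _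
      _ = θ ^ (m + 1) * Pr A := by ring

theorem IsMarkovChain.lintegral_prod_le [IsProbabilityMeasure Pr]
    (hY : IsMarkovChain Pr Y i₀ P) {w : Fin N → Fin N → ℝ≥0∞} {θ : ℝ≥0∞}
    (hw : ∀ i, ∑ j, ENNReal.ofReal (P i j) * w i j ≤ θ) (m : ℕ) :
    ∫⁻ ω, ∏ l ∈ Finset.range m, w (Y l ω) (Y (l + 1) ω) ∂Pr ≤ θ ^ m := by
  have h0 : ∀ᵐ ω ∂Pr, ω ∈ {ω | ∀ l ≤ 0, Y l ω = (fun _ => i₀) l} := by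
    have h1 : ∀ᵐ y ∂(Pr.map (Y 0)), y = i₀ := by
      rw [hY.initial]
      exact (ae_dirac_iff (measurableSet_singleton i₀)).2 rfl
    filter_upwards [ae_of_ae_map (hY.measurable 0).aemeasurable h1] with ω hω l hl
    rwa [Nat.le_zero.1 hl]
  have h := hY.setLIntegral_prod_le hw m 0 (fun _ => i₀)
  rw [Measure.restrict_eq_self_of_ae_mem h0] at h
  simp only [zero_add] at h
  exact h.trans (mul_le_of_le_one_right' prob_le_one)

end MarkovChain

/-! ### Signals of class GH: divergence of the instants and decay of the products -/

section ClassGH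

variable {Ω : Type*} [MeasurableSpace Ω] {Pr : Measure Ω} {N : ℕ}
  {σ : ℝ → Ω → Fin N} {τ : ℕ → Ω → ℝ} {σ₀ : Fin N} {P : Matrix (Fin N) (Fin N) ℝ}

theorem IsSwitchingSignal.measurable_holdingTime (hσ : IsSwitchingSignal Pr σ τ) (k : ℕ) :
    Measurable (holdingTime τ k) :=
  (hσ.measurable_instant (k + 1)).sub (hσ.measurable_instant k)

variable [IsProbabilityMeasure Pr]

/-- The switching instants of a signal of class GH almost surely tend to infinity. -/
theorem IsClassGH.tendsto_instant (hσ : IsSwitchingSignal Pr σ τ)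
    (hGH : IsClassGH Pr σ τ σ₀ P) : ∀ᵐ ω ∂Pr, Tendsto (fun k => τ k ω) atTop atTop := by
  have hpos : ∀ᵐ ω ∂Pr, 0 < holdingTime τ 0 ω := by
    filter_upwards [hσ.instant_strictMono] with ω hω
    exact sub_pos.2 (hω Nat.zero_lt_one)
  have hmean : 0 < ∫ ω, holdingTime τ 0 ω ∂Pr := by
    refine (integral_pos_iff_support_of_nonneg_ae (hpos.mono fun ω h => h.le) hGH.integrable).2 ?_
    have : Function.support (holdingTime τ 0) =ᵐ[Pr] Set.univ := by
      filter_upwards [hpos] with ω hω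
      exact propext (iff_of_true hω.ne' trivial)
    rw [measure_congr this]
    simp
  -- The holding times telescope, so the strong law says that `τ k / k` tends to the mean, which is
  -- positive.
  filter_upwards [hσ.instant_zero, strong_law_ae_real _ hGH.integrable
    (fun i j hij => hGH.iIndep.indepFun hij) hGH.identDistrib] with ω h0 h
  have h1 := h.pos_mul_atTop hmean tendsto_natCast_atTop_atTop
  refine (tendsto_congr' ?_).1 h1
  filter_upwards [eventually_gt_atTop 0] with k hk
  have hk' : (k : ℝ) ≠ 0 := Nat.cast_ne_zero.2 hk.ne'
  rw [div_mul_cancel₀ _ hk']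
  simp only [holdingTime]
  rw [Finset.sum_range_sub (fun k => τ k ω), h0, sub_zero]

/-- For a frozen mode sequence the factors are independent, so the expectation becomes a product of
transition weights `w`. Working in `[0, ∞]` admits infinite weights on transitions of probability
zero. -/
theorem IsClassGH.lintegral_decayFactor_le (hσ : IsSwitchingSignal Pr σ τ)
    (hGH : IsClassGH Pr σ τ σ₀ P) {μ : ℝ} (hμ : 0 ≤ μ) {lam : Fin N → Fin N → ℝ} {θ : ℝ≥0∞}
    (hθ : ∀ i, (∑ j, ENNReal.ofReal (μ * P i j) *
      ∫⁻ ω, ENNReal.ofReal (Real.exp (-lam j i * holdingTime τ 0 ω)) ∂Pr) ≤ θ) (k : ℕ) :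
    ∫⁻ ω, ENNReal.ofReal (decayFactor μ lam (fun l => jumpDestination σ τ l ω)
      (fun l => holdingTime τ l ω) k) ∂Pr ≤ θ ^ k := by
  let g : Fin N → Fin N → ℝ → ℝ≥0∞ := fun i j u =>
    ENNReal.ofReal μ * ENNReal.ofReal (Real.exp (-lam j i * u))
  have hg : ∀ i j, Measurable (g i j) := fun i j => by fun_prop
  let F : (ℕ → ℝ) × (ℕ → Fin N) → ℝ≥0∞ := fun p =>
    ∏ l ∈ Finset.range k, g (p.2 l) (p.2 (l + 1)) (p.1 l)
  have hF : Measurable F := by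
    refine Finset.measurable_prod _ fun l _ => ?_
    have h1 : Measurable fun q : (Fin N × Fin N) × ℝ => g q.1.1 q.1.2 q.2 :=
      measurable_from_prod_countable_right fun q => hg q.1 q.2
    exact h1.comp (f := fun p : (ℕ → ℝ) × (ℕ → Fin N) => ((p.2 l, p.2 (l + 1)), p.1 l))
      (by fun_prop)
  have hS : Measurable fun ω l => holdingTime τ l ω :=
    measurable_pi_lambda _ hσ.measurable_holdingTime
  have hY : Measurable fun ω l => jumpDestination σ τ l ω :=
    measurable_pi_lambda _ hGH.markov.measurable
  let w : Fin N → Fin N → ℝ≥0∞ := fun i j => ∫⁻ ω, g i j (holdingTime τ 0 ω) ∂Pr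
  have hw : ∀ i, ∑ j, ENNReal.ofReal (P i j) * w i j ≤ θ := by
    intro i
    refine le_trans (Finset.sum_le_sum fun j _ => ?_) (hθ i)
    simp only [w, g]
    rw [lintegral_const_mul' _ _ ENNReal.ofReal_ne_top, ENNReal.ofReal_mul hμ, ← mul_assoc,
      mul_comm (ENNReal.ofReal (P i j))]
  have hinner : ∀ y : ℕ → Fin N, ∫⁻ ω, F (fun l => holdingTime τ l ω, y) ∂Pr =
      ∏ l ∈ Finset.range k, w (y l) (y (l + 1)) := by
    intro y
    have hind : iIndepFun (fun l => g (y l) (y (l + 1)) ∘ holdingTime τ l) Pr :=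
      hGH.iIndep.comp _ fun l => hg _ _
    have := lintegral_prod_eq_prod_lintegral_of_indepFun (Finset.range k) _ hind
      fun l => (hg _ _).comp (hσ.measurable_holdingTime l)
    refine this.trans (Finset.prod_congr rfl fun l _ => ?_)
    exact ((hGH.identDistrib l).comp (hg (y l) (y (l + 1)))).lintegral_eq
  calc _ = ∫⁻ ω, F (fun l => holdingTime τ l ω, fun l => jumpDestination σ τ l ω) ∂Pr := by
        refine lintegral_congr fun ω => ?_
        simp only [F, g, decayFactor]
        rw [ENNReal.ofReal_prod_of_nonneg fun l _ => mul_nonneg hμ (Real.exp_pos _).le]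
        exact Finset.prod_congr rfl fun l _ => ENNReal.ofReal_mul hμ
    -- Independence of the two sequences makes their joint law a product; the holding times are
    -- integrated first.
    _ = ∫⁻ y, ∫⁻ u, F (u, y) ∂(Pr.map fun ω l => holdingTime τ l ω)
          ∂(Pr.map fun ω l => jumpDestination σ τ l ω) := by
        rw [← lintegral_prod_symm' _ hF,
          ← (indepFun_iff_map_prod_eq_prod_map_map hS.aemeasurable hY.aemeasurable).1 hGH.indep,
          lintegral_map hF (hS.prodMk hY)]
    _ = ∫⁻ ω, ∏ l ∈ Finset.range k,
          w (jumpDestination σ τ l ω) (jumpDestination σ τ (l + 1) ω) ∂Pr := by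
        rw [lintegral_map hF.lintegral_prod_left' hY]
        refine lintegral_congr fun ω => ?_
        exact (lintegral_map (hF.comp measurable_prodMk_right) hS).trans (hinner _)
    _ ≤ θ ^ k := hGH.markov.lintegral_prod_le hw k

/-- The sum of all the products has expectation at most the geometric series in `θ`, so it is almost
surely finite and its terms tend to zero. -/
theorem IsClassGH.tendsto_decayFactor (hσ : IsSwitchingSignal Pr σ τ)
    (hGH : IsClassGH Pr σ τ σ₀ P) {μ : ℝ} (hμ : 0 < μ) {lam : Fin N → Fin N → ℝ} {θ : ℝ≥0∞}
    (hθ_lt : θ < 1) (hθ : ∀ i, (∑ j, ENNReal.ofReal (μ * P i j) *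
      ∫⁻ ω, ENNReal.ofReal (Real.exp (-lam j i * holdingTime τ 0 ω)) ∂Pr) ≤ θ) :
    ∀ᵐ ω ∂Pr, Tendsto (decayFactor μ lam (fun l => jumpDestination σ τ l ω)
      (fun l => holdingTime τ l ω)) atTop (𝓝 0) := by
  set M : ℕ → Ω → ℝ := fun k ω => decayFactor μ lam (fun l => jumpDestination σ τ l ω)
    (fun l => holdingTime τ l ω) k with hM
  have hmeas : ∀ k, Measurable (M k) := by
    intro k
    refine Finset.measurable_prod _ fun l _ => ?_
    have h1 : Measurable fun ω =>
        lam (jumpDestination σ τ (l + 1) ω) (jumpDestination σ τ l ω) :=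
      (measurable_of_countable (fun p : Fin N × Fin N => lam p.1 p.2)).comp
        ((hGH.markov.measurable _).prodMk (hGH.markov.measurable _))
    exact ((h1.neg.mul (hσ.measurable_holdingTime l)).exp).const_mul μ
  have hsum : ∫⁻ ω, ∑' k, ENNReal.ofReal (M k ω) ∂Pr ≠ ∞ := by
    rw [lintegral_tsum fun k => (hmeas k).ennreal_ofReal.aemeasurable]
    refine ne_top_of_le_ne_top ?_
      (ENNReal.tsum_le_tsum fun k => hGH.lintegral_decayFactor_le hσ hμ.le hθ k)
    rw [ENNReal.tsum_geometric, Ne, ENNReal.inv_eq_top]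
    exact (tsub_pos_of_lt hθ_lt).ne'
  filter_upwards [ae_lt_top (Measurable.tsum fun k => (hmeas k).ennreal_ofReal) hsum]
    with ω hω
  have h := ENNReal.tendsto_atTop_zero_of_tsum_ne_top hω.ne
  have h2 := (ENNReal.tendsto_toReal ENNReal.zero_ne_top).comp h
  refine h2.congr fun k => ?_
  exact ENNReal.toReal_ofReal (decayFactor_pos hμ _ _ _).le

end ClassGH

/-! ### Almost sure well-posedness and stability -/

theorem mainTheorem3 {Ω : Type*} [MeasurableSpace Ω] (Pr : Measure Ω) [IsProbabilityMeasure Pr]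
    {n N : ℕ}
    -- the family of subsystems
    (f : Fin N → EuclideanSpace ℝ (Fin n) → EuclideanSpace ℝ (Fin n))
    (hf_lip : ∀ i, LocallyLipschitz (f i)) (hf_zero : ∀ i, f i 0 = 0)
    -- the switching signal, of class GH
    (σ : ℝ → Ω → Fin N) (τ : ℕ → Ω → ℝ) (hσ : IsSwitchingSignal Pr σ τ)
    (σ₀ : Fin N) (P : Matrix (Fin N) (Fin N) ℝ) (hGH : IsClassGH Pr σ τ σ₀ P)
    -- the Lyapunov functions
    (V : Fin N → EuclideanSpace ℝ (Fin n) → ℝ) (hV : ∀ i, ContDiff ℝ 1 (V i))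
    (α₁ α₂ : ℝ≥0 → ℝ≥0) (hα₁ : IsClassKInfty α₁) (hα₂ : IsClassKInfty α₂)
    (μ : ℝ) (hμ : 1 < μ) (lam : Fin N → Fin N → ℝ)
    (hV1 : ∀ i x, (α₁ ‖x‖₊ : ℝ) ≤ V i x ∧ V i x ≤ (α₂ ‖x‖₊ : ℝ))
    (hV2 : ∀ i j x, lieDeriv (f j) (V i) x ≤ -lam i j * V i x)
    (hV3 : ∀ i j x, V i x ≤ μ * V j x)
    -- the contraction condition, with expectations in `[0, ∞]` (so that `0 * ∞ = 0`)
    (θ : ℝ) (hθ_nonneg : 0 ≤ θ) (hθ_lt : θ < 1)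
    (hG3 : ∀ i, (∑ j, ENNReal.ofReal (μ * P i j) *
      ∫⁻ ω, ENNReal.ofReal (Real.exp (-lam j i * holdingTime τ 0 ω)) ∂Pr) ≤ ENNReal.ofReal θ) :
    AlmostSurelyWellPosed Pr f σ ∧ GASAlmostSurely Pr f σ := by
  have hf : ∀ i, Continuous (f i) := fun i => (hf_lip i).continuous
  have hμ0 : 0 < μ := one_pos.trans hμ
  have hV0 : ∀ i x, 0 ≤ V i x := fun i x => (NNReal.coe_nonneg _).trans (hV1 i x).1
  have hVp : ∀ i C, ∃ R, ∀ y, V i y ≤ C → ‖y‖ ≤ R := by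
    intro i C
    obtain ⟨R, hR⟩ := (hα₁.unbounded.eventually_gt_atTop C.toNNReal).exists
    refine ⟨R, fun y hy => ?_⟩
    have h1 : α₁ ‖y‖₊ < α₁ R :=
      (NNReal.le_toNNReal_of_coe_le ((hV1 i y).1.trans hy)).trans_lt hR
    exact (hα₁.strictMono.lt_iff_lt.1 h1).le
  have hpath : ∀ᵐ ω ∂Pr, IsSwitchingPath (fun t => σ t ω) fun k => τ k ω := by
    filter_upwards [hσ.instant_zero, hσ.instant_strictMono, hGH.tendsto_instant hσ, hσ.eq_of_mem]
      with ω h1 h2 h3 h4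
    exact ⟨h1, h2, h3, h4⟩
  have hdecay := hGH.tendsto_decayFactor hσ hμ0 (θ := ENNReal.ofReal θ)
    (ENNReal.ofReal_lt_one.2 hθ_lt) hG3
  -- The weights `c` are chosen before the solution, so `δ` and `T` below do not depend on the
  -- initial state.
  have hbound : ∀ᵐ ω ∂Pr, ∃ c : ℕ → ℝ, (∀ k, 0 ≤ c k) ∧ Tendsto c atTop (𝓝 0) ∧
      ∀ x₀ x, IsSwitchedSolution f (fun t => σ t ω) x₀ x →
        ∀ k, ∀ t ∈ Set.Icc (τ k ω) (τ (k + 1) ω),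
          V (σ (τ (k + 1) ω) ω) (x t) ≤ c k * V (σ (τ 0 ω) ω) x₀ := by
    filter_upwards [hpath, hdecay] with ω hs hM
    set M := decayFactor μ lam (fun l => jumpDestination σ τ l ω) (fun l => holdingTime τ l ω)
      with hMdef
    have hM0 : ∀ k, 0 < M k := decayFactor_pos hμ0 _ _
    refine ⟨fun k => μ * M k + M (k + 1),
      fun k => add_nonneg (mul_nonneg hμ0.le (hM0 k).le) (hM0 _).le, ?_, ?_⟩
    · simpa using (hM.const_mul μ).add ((tendsto_add_atTop_iff_nat 1).2 hM)
    · intro x₀ x hx k t ht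
      exact hx.lyapunov_le hs hf hV hV0 hμ0 hV2 hV3 hMdef k ht
  refine ⟨?_, ?_, ?_⟩
  · filter_upwards [hpath] with ω hs x₀
    obtain ⟨x, hx⟩ := IsSwitchedSolution.exists_of_exists_Icc hs hf (fun i a b hab z =>
      exists_eq_integral_of_lieDeriv_le (hf_lip i) (hV i) (hV0 i) (hVp i) (hV2 i i) hab z) x₀
    exact ⟨x, hx, fun y hy => hx.eqOn_Ici hs hf_lip hy⟩
  · filter_upwards [hpath, hbound] with ω hs ⟨c, hc0, hc, hb⟩ ε hε
    obtain ⟨C, hC⟩ := hc.bddAbove_range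
    have hC' : ∀ k, c k ≤ C := fun k => hC ⟨k, rfl⟩
    have hpos : (0 : ℝ) < α₁ (ε / 2).toNNReal := by
      have := hα₁.strictMono (Real.toNNReal_pos.2 (half_pos hε))
      rw [hα₁.map_zero] at this
      exact_mod_cast this
    have hlim : Tendsto (fun r : ℝ => C * (α₂ r.toNNReal : ℝ)) (𝓝[>] 0) (𝓝 0) := by
      have h1 : Continuous fun r : ℝ => C * (α₂ r.toNNReal : ℝ) :=
        continuous_const.mul
          (NNReal.continuous_coe.comp (hα₂.continuous.comp continuous_real_toNNReal))
      have h2 := h1.tendsto 0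
      simp only [Real.toNNReal_zero, hα₂.map_zero, NNReal.coe_zero, mul_zero] at h2
      exact h2.mono_left nhdsWithin_le_nhds
    -- `C` bounds all the weights; continuity of `α₂` at zero makes `C * α₂ δ` smaller than `α₁ (ε /
    -- 2)`.
    obtain ⟨δ, hδ, hδ0⟩ :=
      ((hlim.eventually_lt_const hpos).and self_mem_nhdsWithin).exists
    refine ⟨δ, hδ0, fun x₀ x hx hx₀ => ?_⟩
    have := iSup_enorm_lt_of_lyapunov_le hs hα₁.strictMono hα₂.strictMono.monotone hV1 hc0
      (hb x₀ x hx) (K := 0) hx₀ hε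
      (fun k _ => (mul_le_mul_of_nonneg_right (hC' k) (NNReal.coe_nonneg _)).trans_lt hδ)
    rwa [hs.zero] at this
  · filter_upwards [hpath, hbound] with ω hs ⟨c, hc0, hc, hb⟩ r ε hr hε
    have hpos : (0 : ℝ) < α₁ (ε / 2).toNNReal := by
      have := hα₁.strictMono (Real.toNNReal_pos.2 (half_pos hε))
      rw [hα₁.map_zero] at this
      exact_mod_cast this
    have hlim : Tendsto (fun k => c k * (α₂ r.toNNReal : ℝ)) atTop (𝓝 0) := by
      simpa using hc.mul_const (α₂ r.toNNReal : ℝ)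
    obtain ⟨K, hK⟩ := eventually_atTop.1 (hlim.eventually_lt_const hpos)
    exact ⟨τ K ω, hs.nonneg K, fun x₀ x hx hx₀ =>
      iSup_enorm_lt_of_lyapunov_le hs hα₁.strictMono hα₂.strictMono.monotone hV1 hc0
        (hb x₀ x hx) hx₀ hε hK⟩
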